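/- Fix $K\ge 1$, numbers of factors $r_1,\dots,r_K$, and sets $\mathcal A_k\subset\mathbb R^{r_k}$ ($1\le k\le K$), $\mathcal F\subset\mathbb R^{r_1\times\cdots\times r_K}$. Consider an array of tensor factor models, indexed by $n$, with sample size $T=T^{(n)}$ and dimensions $p_k=p_k^{(n)}$ such that $\min\{T,p_1,\dots,p_K\}\to\infty$ in an arbitrary way; below the index $n$ is suppressed, while $K$, $r_k$, $\mathcal A_k$, $\mathcal F$ and the constants $c_k,\nu,\mathbf\Sigma_{0k}$ do not depend on it. Put $p=p_1\cdots p_K$, $p_{-k}=p/p_k$, and $$\mathcal X_t=\mathcal S_{0t}+\mathcal E_t,\qquad \mathcal S_{0t}=\mathcal F_{0t}\times_{1}\mathbf A_{01}\times_2\cdots\times_K\mathbf A_{0K}\in\mathbb R^{p_1\times\cdots\times p_K},\qquad 1\le t\le T,$$ with $\mathcal F_{0t}\in\mathbb R^{r_1\times\cdots\times r_K}$, $\mathbf A_{0k}\in\mathbb R^{p_k\times r_k}$, $\mathcal E_t=(e_{t,i_1,\dots,i_K})$ random, and $\times_k$ the mode-$k$ product. Let $\Theta$ be the set of all $\theta=\{\mathbf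 A_1,\dots,\mathbf A_K,\mathcal F_1,\dots,\mathcal F_T\}$ such that the rows of $\mathbf A_k$ lie in $\mathcal A_k$, $\mathbf A_k^\top\mathbf A_k/p_k=\mathbf I_{r_k}$, $\mathcal F_t\in\mathcal F$, and, for every $k$, $T^{-1}\sum_{t=1}^T\mathbf F_{k,t}\mathbf F_{k,t}^\top$ is diagonal with positive non-increasing diagonal elements, where $\mathbf F_{k,t}=\mathrm{mat}_k(\mathcal F_t)$ is the mode-$k$ unfolding. Assume: 1. $\mathcal A_1,\dots,\mathcal A_K$ and $\mathcal F$ are closed; $\theta_0=\{\mathbf A_{01},\dots,\mathbf A_{0K},\mathcal F_{01},\dots,\mathcal F_{0T}\}$ is nonrandom and lies in $\Theta$; there are $0<c_k<\infty$ with $\|\mathbf A_{0k}\|_F=c_kp_k^{1/2}$; and, for every $k$, $T^{-1}\sum_{t=1}^T\mathbf F_{0k,t}\mathbf F_{0k,t}^\top\to\mathbf\Sigma_{0k}$, with $\mathbf F_{0k,t}=\mathrm{mat}_k(\mathcal F_{0t})$ and $\mathbf\Sigma_{0k}$ a positive definite diagonal matrix with non-increasing diagonal elements. 2. The random variables $e_{t,i_1,\dots,i_K}$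 are independent across $t$ and $(i_1,\dots,i_K)$. 3. $\mathbb E\,e_{t,i_1,\dots,i_K}=0$; there is $\nu>0$ with $\mathbb E|e_{t,i_1,\dots,i_K}|^{2d}\le\frac{(2d)!}{2^d d!}\nu^{2d}$ for all $d=1,2,\dots$ and all $t,i_1,\dots,i_K$; and $\|\mathcal E_t\|_F>0$ a.s. for every $t$. Let $\widehat\theta=\{\widehat{\mathbf A}_1,\dots,\widehat{\mathbf A}_K,\widehat{\mathcal F}_1,\dots,\widehat{\mathcal F}_T\}$ be almost surely a minimiser over $\theta\in\Theta$ of $\frac1T\sum_{t=1}^T\|\mathcal X_t-\mathcal F_t\times_{1}\mathbf A_1\times_2\cdots\times_K\mathbf A_K\|_F^2$, and let $\widehat{\mathcal S}_t=\widehat{\mathcal F}_t\times_{1}\widehat{\mathbf A}_1\times_2\cdots\times_K\widehat{\mathbf A}_K$. Then, with $L=\min\{p,Tp_{-1},\dots,Tp_{-K}\}$, $$\frac1{Tp}\sum_{t=1}^T\big\|\widehat{\mathcal S}_t-\mathcal S_{0t}\big\|_F^2=O_P\!\left(\frac1L\right),$$ that is, for every $\varepsilon>0$ there is $M<\infty$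 such that eventually the left-hand side exceeds $M/L$ with probability at most $\varepsilon$. -/

import Mathlib

open Filter Topology MeasureTheory ProbabilityTheory

noncomputable section

namespace TensorFactor

/-- Real tensors of size `d 1 × ⋯ × d K`. -/
abbrev Tensor {K : ℕ} (d : Fin K → ℕ) : Type := (∀ k, Fin (d k)) → ℝ

/-- The Frobenius norm of a tensor. -/
def tensorNorm {K : ℕ} {d : Fin K → ℕ} (X : Tensor d) : ℝ := Real.sqrt (∑ i, X i ^ 2)

/-- The Frobenius norm of a matrix. -/
def frobNorm {m n : ℕ} (A : Matrix (Fin m) (Fin n) ℝ) : ℝ := Real.sqrt (∑ i, ∑ j, A i j ^ 2)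

/-- The tensor `F ×₁ A₁ ×₂ ⋯ ×_K A_K`, entry by entry: carrying out the `K` mode products
`(Y ×ₖ A)_{…, i, …} = ∑ j, Y_{…, j, …} * A i j` one after the other gives this sum. -/
def tuckerProd {K : ℕ} {r p : Fin K → ℕ} (F : Tensor r)
    (A : ∀ k, Matrix (Fin (p k)) (Fin (r k)) ℝ) : Tensor p :=
  fun i => ∑ j : (∀ k, Fin (r k)), F j * ∏ k, A k (i k) (j k)

/-- The mode-`k` unfolding: rows are indexed by the `k`-th coordinate, columns (the mode-`k`
fibres) by the tuple of all the other coordinates. -/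
def unfold {K : ℕ} {r : Fin K → ℕ} (k : Fin K) (F : Tensor r) :
    Matrix (Fin (r k)) (∀ j : {j // j ≠ k}, Fin (r j)) ℝ :=
  Matrix.of fun a c => F ((Equiv.piSplitAt k fun j => Fin (r j)).symm (a, c))

/-- A parameter value: the loading matrices `A₁, …, A_K` and the factor tensors
`F₁, …, F_T`. -/
structure Param {K : ℕ} (r p : Fin K → ℕ) (T : ℕ) where
  A : ∀ k, Matrix (Fin (p k)) (Fin (r k)) ℝ
  F : Fin T → Tensor r

/-- The common component `S_t = F_t ×₁ A₁ ×₂ ⋯ ×_K A_K`. -/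
def Param.signal {K : ℕ} {r p : Fin K → ℕ} {T : ℕ} (θ : Param r p T) (t : Fin T) : Tensor p :=
  tuckerProd (θ.F t) θ.A

/-- The matrix `T⁻¹ ∑ₜ matₖ(F_t) matₖ(F_t)ᵀ`. -/
def factorSecondMoment {K : ℕ} {r : Fin K → ℕ} {T : ℕ} (F : Fin T → Tensor r) (k : Fin K) :
    Matrix (Fin (r k)) (Fin (r k)) ℝ :=
  (T : ℝ)⁻¹ • ∑ t, unfold k (F t) * (unfold k (F t)).transpose

/-- Diagonal, with positive and non-increasing diagonal entries. -/
def IsOrderedPosDiag {m : ℕ} (M : Matrix (Fin m) (Fin m) ℝ) : Prop :=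
  M.IsDiag ∧ (∀ i, 0 < M i i) ∧ Antitone fun i => M i i

/-- The parameter space `Θ`. -/
def paramSpace {K : ℕ} {r : Fin K → ℕ} (rowSet : ∀ k, Set (Fin (r k) → ℝ))
    (factorSet : Set (Tensor r)) (p : Fin K → ℕ) (T : ℕ) : Set (Param r p T) :=
  {θ | (∀ k j, θ.A k j ∈ rowSet k) ∧
       (∀ k, (p k : ℝ)⁻¹ • ((θ.A k).transpose * θ.A k) = 1) ∧
       (∀ t, θ.F t ∈ factorSet) ∧
       ∀ k, IsOrderedPosDiag (factorSecondMoment θ.F k)}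

/-- The least-squares loss `T⁻¹ ∑ₜ ‖X_t - F_t ×₁ A₁ ⋯ ×_K A_K‖_F²`. -/
def lsLoss {K : ℕ} {r p : Fin K → ℕ} {T : ℕ} (X : Fin T → Tensor p) (θ : Param r p T) : ℝ :=
  (T : ℝ)⁻¹ * ∑ t, tensorNorm (X t - θ.signal t) ^ 2

/-- `θ` minimises the least-squares loss for the data `X` over the parameter space. -/
def IsLeastSquares {K : ℕ} {r p : Fin K → ℕ} {T : ℕ} (rowSet : ∀ k, Set (Fin (r k) → ℝ))
    (factorSet : Set (Tensor r)) (X : Fin T → Tensor p) (θ : Param r p T) : Prop :=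
  θ ∈ paramSpace rowSet factorSet p T ∧ IsMinOn (lsLoss X) (paramSpace rowSet factorSet p T) θ

/-- `p = p₁ ⋯ p_K`. -/
def totalDim {K : ℕ} (p : Fin K → ℕ) : ℕ := ∏ k, p k

/-- `p₋ₖ = p / pₖ`, the product of the other dimensions. -/
def codim {K : ℕ} (p : Fin K → ℕ) (k : Fin K) : ℕ := ∏ j ∈ Finset.univ.erase k, p j

/-- `L = min {p, T p₋₁, …, T p₋K}` (for `K ≥ 1`). -/
def rateL {K : ℕ} (p : Fin K → ℕ) (T : ℕ) : ℝ :=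
  min (totalDim p : ℝ) (⨅ k, (T : ℝ) * (codim p k : ℝ))

/-- `X n = O_P(a n)` along the filter `l`: for every `ε > 0` there is `M` such that, eventually,
`P(|X n| > M * a n) ≤ ε`. (No measurability of `X n` is needed: `μ n` is then the outer
probability.) -/
def IsBigOP {ι : Type*} (l : Filter ι) {Ω : ι → Type*} [∀ n, MeasurableSpace (Ω n)]
    (μ : ∀ n, Measure (Ω n)) (X : ∀ n, Ω n → ℝ) (a : ι → ℝ) : Prop :=
  ∀ ε : ℝ, 0 < ε → ∃ M : ℝ, ∀ᶠ n in l, μ n {ω | M * a n < |X n ω|} ≤ ENNReal.ofReal ε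

/-- Conditions on the true (nonrandom) loadings and factors, for an array of models indexed by
`n` with limit along `l`. -/
structure LoadingFactorAssumption {K : ℕ} {r : Fin K → ℕ}
    (rowSet : ∀ k, Set (Fin (r k) → ℝ)) (factorSet : Set (Tensor r))
    {ι : Type*} (l : Filter ι) (T : ι → ℕ) (p : ι → Fin K → ℕ)
    (θ₀ : ∀ n, Param r (p n) (T n)) : Prop where
  rowSet_closed : ∀ k, IsClosed (rowSet k)
  factorSet_closed : IsClosed factorSet
  true_mem : ∀ n, θ₀ n ∈ paramSpace rowSet factorSet (p n) (T n)
  pervasive : ∃ c : Fin K → ℝ, (∀ k, 0 < c k) ∧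
    ∀ n k, frobNorm ((θ₀ n).A k) = c k * Real.sqrt (p n k)
  factor_limit : ∀ k, ∃ S₀ : Matrix (Fin (r k)) (Fin (r k)) ℝ, IsOrderedPosDiag S₀ ∧
    Tendsto (fun n => factorSecondMoment (θ₀ n).F k) l (𝓝 S₀)

/-- The noise entries are independent across time `t` and position `(i₁, …, i_K)`. -/
def NoiseIndependent {K : ℕ} {ι : Type*} (T : ι → ℕ) (p : ι → Fin K → ℕ)
    {Ω : ι → Type*} [∀ n, MeasurableSpace (Ω n)] (μ : ∀ n, Measure (Ω n))
    (E : ∀ n, Fin (T n) → Ω n → Tensor (p n)) : Prop :=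
  ∀ n, iIndepFun (fun (s : Fin (T n) × (∀ k, Fin (p n k))) ω => E n s.1 ω s.2) (μ n)

/-- The noise entries are centred with sub-Gaussian moments, uniformly, and no noise tensor
vanishes. -/
structure NoiseSubGaussian {K : ℕ} {ι : Type*} (T : ι → ℕ) (p : ι → Fin K → ℕ)
    {Ω : ι → Type*} [∀ n, MeasurableSpace (Ω n)] (μ : ∀ n, Measure (Ω n))
    (E : ∀ n, Fin (T n) → Ω n → Tensor (p n)) : Prop where
  integrable : ∀ n t i, Integrable (fun ω => E n t ω i) (μ n)
  mean_zero : ∀ n t i, ∫ ω, E n t ω i ∂(μ n) = 0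
  moments : ∃ ν : ℝ, 0 < ν ∧ ∀ n t i, ∀ d : ℕ, 1 ≤ d →
    Integrable (fun ω => |E n t ω i| ^ (2 * d)) (μ n) ∧
    ∫ ω, |E n t ω i| ^ (2 * d) ∂(μ n)
      ≤ ((2 * d).factorial : ℝ) / (2 ^ d * (d.factorial : ℝ)) * ν ^ (2 * d)
  nonvanishing : ∀ n t, ∀ᵐ ω ∂(μ n), 0 < tensorNorm (E n t ω)

end TensorFactor

end

/-! ### Sub-Gaussian tails from even moments. -/

namespace TensorFactor

/-! Let `Δ` be the estimated minus the true signal. Minimality against the true parameter gives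
`‖Δ‖² ≤ 2⟨E, Δ⟩`. In each mode, `Δ` lies in the span of the columns of two loading matrices, of
dimension at most `2 r_k`. So `⟨E, Δ⟩` sees only at most `∏ 2 r_k` coordinates of each noise tensor,
whatever the sample size and dimensions, and `‖Δ‖²` is at most a constant times the squared
injective norm of the noise, with time as an extra mode (`sum_tensorNorm_sq_le`).

That norm is a supremum of a multilinear form over a product of unit balls. Half-nets, a union bound
and Hoeffding's inequality bound its square by a multiple of `T + p₁ + ⋯ + p_K` with high
probability (`measure_tensorForm_large_le`). Dividing by `T p` turns each summand into at most `1 /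
L` (`sum_dim_div_le`). -/

lemma exp_le_add_cosh (x : ℝ) : Real.exp x ≤ x + Real.cosh (2 * x) := by
  have hc := Real.one_le_cosh x
  have hsq := Real.cosh_sq x
  -- With `c = cosh x` and `s = sinh x`, the bound `c ≤ c ^ 2` reduces the goal to `s - x ≤ s ^ 2`.
  -- For `x ≥ 0`, failure together with `s ≤ x * c` would force `c * (1 - s) > 1`, impossible since
  -- `c ≤ 1 + s`.
  rw [← Real.cosh_add_sinh, Real.cosh_two_mul]
  rcases le_or_gt 0 x with hx | hx
  · have hs : 0 ≤ Real.sinh x := Real.sinh_nonneg_iff.2 hx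
    have ht : Real.sinh x ≤ x * Real.cosh x := by
      have hmono : MonotoneOn (fun y => y * Real.cosh y - Real.sinh y) (Set.Ici 0) := by
        apply monotoneOn_of_deriv_nonneg (convex_Ici 0)
        · fun_prop
        · fun_prop
        · intro y hy
          simp only [interior_Ici, Set.mem_Ioi] at hy
          have : HasDerivAt (fun y => y * Real.cosh y - Real.sinh y)
              (1 * Real.cosh y + y * Real.sinh y - Real.cosh y) y :=
            ((hasDerivAt_id y).mul (Real.hasDerivAt_cosh y)).sub (Real.hasDerivAt_sinh y)
          rw [this.deriv]
          have := Real.sinh_nonneg_iff.2 hy.le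
          nlinarith [mul_nonneg hy.le this]
      have := hmono (Set.mem_Ici.2 le_rfl) (Set.mem_Ici.2 hx) hx
      simp at this
      linarith
    set c := Real.cosh x
    set s := Real.sinh x
    have h2 : s - x ≤ s ^ 2 := by
      by_contra! h
      have h3 : c * x < c * (s - s ^ 2) := by
        apply mul_lt_mul_of_pos_left <;> linarith
      have hs1 : s * (c * (1 - s) - 1) > 0 := by nlinarith
      have h4 : c * (1 - s) - 1 > 0 := by
        by_contra! h5
        nlinarith
      have h6 : c ≤ 1 + s := by nlinarith
      have h7 : s < 1 := by nlinarith
      nlinarith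
    nlinarith
  · have hs : Real.sinh x < x := Real.sinh_lt_self_iff.2 hx
    nlinarith [sq_nonneg (Real.sinh x)]

/-- A centred random variable whose even moments are at most those of `N(0, ν²)` is
sub-Gaussian with variance proxy `4ν²`. -/
lemma hasSubgaussianMGF_of_even_moments {Ω : Type*} [MeasurableSpace Ω] {μ : Measure Ω}
    [IsProbabilityMeasure μ] {X : Ω → ℝ} (hX : Measurable X) (hint : Integrable X μ)
    (hmean : ∫ ω, X ω ∂μ = 0) {ν : ℝ}
    (hmom : ∀ d : ℕ, 1 ≤ d → Integrable (fun ω => |X ω| ^ (2 * d)) μ ∧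
      ∫ ω, |X ω| ^ (2 * d) ∂μ
        ≤ ((2 * d).factorial : ℝ) / (2 ^ d * (d.factorial : ℝ)) * ν ^ (2 * d)) :
    HasSubgaussianMGF X (4 * ν ^ 2).toNNReal μ := by
  have key : ∀ t : ℝ, ∫⁻ ω, ENNReal.ofReal (Real.cosh (2 * (t * X ω))) ∂μ ≤
      ENNReal.ofReal (Real.exp (2 * t ^ 2 * ν ^ 2)) := by
    intro t
    have hpos : ∀ d : ℕ, ∀ y : ℝ, 0 ≤ y ^ (2 * d) / ((2 * d).factorial : ℝ) := fun d y =>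
      div_nonneg ((even_two_mul d).pow_nonneg y) (by positivity)
    have e1 : ∀ ω, ENNReal.ofReal (Real.cosh (2 * (t * X ω))) =
        ∑' d : ℕ, ENNReal.ofReal ((2 * (t * X ω)) ^ (2 * d) / ((2 * d).factorial : ℝ)) := by
      intro ω
      have h := Real.hasSum_cosh (2 * (t * X ω))
      rw [← h.tsum_eq, ENNReal.ofReal_tsum_of_nonneg (fun d => hpos d _) h.summable]
    have e2 := NormedSpace.expSeries_div_hasSum_exp (𝔸 := ℝ) (2 * t ^ 2 * ν ^ 2)
    rw [← Real.exp_eq_exp_ℝ] at e2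
    simp_rw [e1]
    rw [lintegral_tsum (fun d => by fun_prop), ← e2.tsum_eq,
      ENNReal.ofReal_tsum_of_nonneg (fun d => by positivity) e2.summable]
    -- The factor `(2 * d)!` in the moment bound cancels the one in the cosh series, leaving the
    -- exponential series of `2 * t ^ 2 * ν ^ 2`.
    refine ENNReal.tsum_le_tsum fun d => ?_
    rcases Nat.eq_zero_or_pos d with rfl | hd
    · simp
    · obtain ⟨hi, hm⟩ := hmom d hd
      have e3 : ∀ ω, (2 * (t * X ω)) ^ (2 * d) / ((2 * d).factorial : ℝ) =
          ((2 * t) ^ (2 * d) / ((2 * d).factorial : ℝ)) * |X ω| ^ (2 * d) := by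
        intro ω
        rw [(even_two_mul d).pow_abs, ← mul_assoc, mul_pow]; ring
      simp_rw [e3]
      rw [← ofReal_integral_eq_lintegral_ofReal (hi.const_mul _)
        (ae_of_all _ fun ω => mul_nonneg (hpos d _) (by positivity)), integral_const_mul]
      apply ENNReal.ofReal_le_ofReal
      refine (mul_le_mul_of_nonneg_left hm (hpos d _)).trans_eq ?_
      have h4 : (2 : ℝ) ^ (2 * d) = 2 ^ d * 2 ^ d := by rw [two_mul, pow_add]
      have h5 : (2 * t ^ 2 * ν ^ 2) ^ d = 2 ^ d * t ^ (2 * d) * ν ^ (2 * d) := by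
        rw [mul_pow, mul_pow, pow_mul, pow_mul]
      rw [h5, mul_pow, h4]
      field_simp
  have hcosh : ∀ t : ℝ, Integrable (fun ω => Real.cosh (2 * (t * X ω))) μ := by
    intro t
    refine ⟨(by fun_prop : Measurable _).aestronglyMeasurable, ?_⟩
    rw [hasFiniteIntegral_iff_ofReal (ae_of_all _ fun ω => (Real.cosh_pos _).le)]
    exact (key t).trans_lt ENNReal.ofReal_lt_top
  have hsum : ∀ t : ℝ, Integrable (fun ω => t * X ω + Real.cosh (2 * (t * X ω))) μ :=
    fun t => (hint.const_mul t).add (hcosh t)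
  have hexp : ∀ t : ℝ, Integrable (fun ω => Real.exp (t * X ω)) μ := fun t =>
    (hsum t).mono' (by fun_prop : Measurable _).aestronglyMeasurable
      (ae_of_all _ fun ω => by
        rw [Real.norm_of_nonneg (Real.exp_pos _).le]; exact exp_le_add_cosh _)
  refine ⟨hexp, fun t => ?_⟩
  -- The linear term integrates to zero, so only even moments remain and no symmetrisation is
  -- needed.
  calc mgf X μ t ≤ ∫ ω, (t * X ω + Real.cosh (2 * (t * X ω))) ∂μ :=
        integral_mono (hexp t) (hsum t) fun ω => exp_le_add_cosh _
    _ = ∫ ω, Real.cosh (2 * (t * X ω)) ∂μ := by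
        rw [integral_add (hint.const_mul t) (hcosh t), integral_const_mul, hmean]; simp
    _ ≤ Real.exp (2 * t ^ 2 * ν ^ 2) := by
        rw [integral_eq_lintegral_of_nonneg_ae (ae_of_all _ fun ω => (Real.cosh_pos _).le)
          (hcosh t).aestronglyMeasurable]
        exact ENNReal.toReal_le_of_le_ofReal (Real.exp_pos _).le (key t)
    _ = _ := by rw [Real.coe_toNNReal _ (by positivity)]; congr 1; ring

/-- Two-sided Hoeffding bound for a linear form with coefficients in the unit ball. -/
lemma measure_abs_linear_ge_le {Ω S : Type*} [Fintype S] [MeasurableSpace Ω] {μ : Measure Ω}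
    [IsProbabilityMeasure μ] {e : S → Ω → ℝ} (hind : iIndepFun e μ) {c : NNReal}
    (hsub : ∀ s, HasSubgaussianMGF (e s) c μ) (a : S → ℝ) (ha : ∑ s, a s ^ 2 ≤ 1)
    {x : ℝ} (hx : 0 ≤ x) :
    μ {ω | x ≤ |∑ s, a s * e s ω|} ≤ ENNReal.ofReal (2 * Real.exp (-x ^ 2 / (2 * c))) := by
  have main : ∀ a : S → ℝ, ∑ s, a s ^ 2 ≤ 1 →
      μ.real {ω | x ≤ ∑ s, a s * e s ω} ≤ Real.exp (-x ^ 2 / (2 * c)) := by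
    intro a ha
    have hind' : iIndepFun (fun s ω => a s * e s ω) μ :=
      hind.comp (fun s y => a s * y) fun s => by fun_prop
    have hs := HasSubgaussianMGF.sum_of_iIndepFun hind' (s := Finset.univ)
      fun s _ => (hsub s).const_mul (a s)
    have hle : ((∑ s, (.mk (a s ^ 2) (sq_nonneg _) * c : NNReal) : NNReal) : ℝ) ≤ c := by
      have : ((∑ s, (.mk (a s ^ 2) (sq_nonneg _) * c : NNReal) : NNReal) : ℝ) =
          ∑ s, a s ^ 2 * c := by rw [NNReal.coe_sum]; rfl
      rw [this, ← Finset.sum_mul]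
      exact mul_le_of_le_one_left c.2 ha
    have hs' : HasSubgaussianMGF (fun ω => ∑ s, a s * e s ω) c μ :=
      ⟨hs.integrable_exp_mul, fun t => (hs.mgf_le t).trans (Real.exp_le_exp.2 (by gcongr; exact hle))⟩
    exact hs'.measure_ge_le hx
  have h1 := main a ha
  have h2 := main (fun s => -a s) (by simpa using ha)
  have hsub : {ω | x ≤ |∑ s, a s * e s ω|} ⊆
      {ω | x ≤ ∑ s, a s * e s ω} ∪ {ω | x ≤ ∑ s, -a s * e s ω} := by
    intro ω hω
    rcases le_abs.1 (show x ≤ |∑ s, a s * e s ω| from hω) with h | h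
    · exact Or.inl h
    · right
      simpa [Finset.sum_neg_distrib] using h
  rw [← ofReal_measureReal]
  apply ENNReal.ofReal_le_ofReal
  calc _ ≤ _ := measureReal_mono hsub
    _ ≤ _ := measureReal_union_le _ _
    _ ≤ _ := by linarith

end TensorFactor

/-! ### Nets and the injective norm of a random tensor. -/

namespace TensorFactor

/-- The unit ball of a `d`-dimensional space has a `1/2`-net with at most `5 ^ d` points. -/
lemma exists_half_net (E : Type*) [NormedAddCommGroup E] [NormedSpace ℝ E]
    [FiniteDimensional ℝ E] :
    ∃ N : Finset E, N.card ≤ 5 ^ Module.finrank ℝ E ∧ (∀ c ∈ N, ‖c‖ ≤ 1) ∧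
      ∀ x : E, ‖x‖ ≤ 1 → ∃ c ∈ N, ‖x - c‖ ≤ 1 / 2 := by
  classical
  -- A 1-separated set of maximal cardinality in the ball of radius 2 covers that ball at scale 1;
  -- halving it gives the net.
  let P : Finset E → Prop := fun s =>
    (∀ c ∈ s, ‖c‖ ≤ 2) ∧ ∀ c ∈ s, ∀ d ∈ s, c ≠ d → 1 ≤ ‖c - d‖
  let C : Set ℕ := {n | ∃ s, P s ∧ s.card = n}
  have hC : BddAbove C := ⟨5 ^ Module.finrank ℝ E, by
    rintro _ ⟨s, hs, rfl⟩
    exact Besicovitch.card_le_of_separated s hs.1 hs.2⟩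
  obtain ⟨s, hs, hcard⟩ : sSup C ∈ C := Nat.sSup_mem ⟨0, ∅, by simp [P], rfl⟩ hC
  have hcover : ∀ x : E, ‖x‖ ≤ 2 → ∃ c ∈ s, ‖x - c‖ ≤ 1 := by
    intro x hx
    by_contra! h
    have hxs : x ∉ s := fun hxs => by simpa using (h x hxs).trans_le' zero_le_one
    have hP : P (insert x s) := by
      refine ⟨by simpa [hx] using hs.1, ?_⟩
      intro c hc d hd hcd
      rw [Finset.mem_insert] at hc hd
      rcases hc with rfl | hc <;> rcases hd with rfl | hd
      · exact absurd rfl hcd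
      · exact (h d hd).le
      · rw [norm_sub_rev]; exact (h c hc).le
      · exact hs.2 c hc d hd hcd
    have := le_csSup hC ⟨_, hP, rfl⟩
    rw [Finset.card_insert_of_notMem hxs] at this
    omega
  refine ⟨s.image fun c => (1 / 2 : ℝ) • c,
    Finset.card_image_le.trans (Besicovitch.card_le_of_separated s hs.1 hs.2), ?_, ?_⟩
  · intro c hc
    obtain ⟨c', hc', rfl⟩ := Finset.mem_image.1 hc
    rw [norm_smul]
    have := hs.1 c' hc'
    norm_num
    linarith
  · intro x hx
    obtain ⟨c, hc, h⟩ := hcover ((2 : ℝ) • x) (by rw [norm_smul]; norm_num; linarith)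
    refine ⟨_, Finset.mem_image_of_mem _ hc, ?_⟩
    have : x - (1 / 2 : ℝ) • c = (1 / 2 : ℝ) • ((2 : ℝ) • x - c) := by
      rw [smul_sub, smul_smul]; norm_num
    rw [this, norm_smul]
    norm_num
    linarith

/-- A linear functional bounded by `M` on a `1/2`-net is bounded by `2M` on the unit ball. -/
lemma abs_le_two_mul_of_half_net {E : Type*} [NormedAddCommGroup E] [NormedSpace ℝ E]
    [FiniteDimensional ℝ E] {N : Set E}
    (hN : ∀ x : E, ‖x‖ ≤ 1 → ∃ c ∈ N, ‖x - c‖ ≤ 1 / 2) (f : E →ₗ[ℝ] ℝ) {M : ℝ}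
    (hM : ∀ c ∈ N, |f c| ≤ M) {x : E} (hx : ‖x‖ ≤ 1) : |f x| ≤ 2 * M := by
  let g : E →L[ℝ] ℝ := LinearMap.toContinuousLinearMap f
  have hg : ∀ y, g y = f y := fun y => rfl
  have hM0 : 0 ≤ M := by
    obtain ⟨c, hc, -⟩ := hN 0 (by simp)
    exact (abs_nonneg _).trans (hM c hc)
  have hnorm : ∀ y : E, ‖y‖ ≤ 1 → ‖g y‖ ≤ M + ‖g‖ / 2 := by
    intro y hy
    obtain ⟨c, hc, hyc⟩ := hN y hy
    have h1 : g y = g c + g (y - c) := by rw [map_sub]; ring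
    have h2 : ‖g (y - c)‖ ≤ ‖g‖ * (1 / 2) :=
      (g.le_opNorm _).trans (mul_le_mul_of_nonneg_left hyc (norm_nonneg _))
    have h3 : ‖g c‖ ≤ M := hM c hc
    rw [h1]
    linarith [norm_add_le (g c) (g (y - c))]
  -- The operator norm appears on both sides; absorbing it gives `‖g‖ ≤ 2 * M`.
  have hle : ‖g‖ ≤ M + ‖g‖ / 2 := by
    refine g.opNorm_le_of_unit_norm (by positivity) fun y hy => hnorm y hy.le
  have h3 : ‖g x‖ ≤ _ := hnorm x hx
  rw [Real.norm_eq_abs, hg] at h3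
  linarith

/-- A multilinear form bounded by `M` on a product of `1/2`-nets is bounded by `2 ^ k * M` on the
product of the `k` unit balls. -/
lemma multilinear_abs_le_of_half_nets {κ : Type*} [Fintype κ] [DecidableEq κ] {E : κ → Type*}
    [∀ k, NormedAddCommGroup (E k)] [∀ k, NormedSpace ℝ (E k)] [∀ k, FiniteDimensional ℝ (E k)]
    {N : ∀ k, Set (E k)} (hN : ∀ k, ∀ x : E k, ‖x‖ ≤ 1 → ∃ c ∈ N k, ‖x - c‖ ≤ 1 / 2)
    (f : MultilinearMap ℝ E ℝ) {M : ℝ} (hM : ∀ b : ∀ k, E k, (∀ k, b k ∈ N k) → |f b| ≤ M)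
    (b : ∀ k, E k) (hb : ∀ k, ‖b k‖ ≤ 1) : |f b| ≤ 2 ^ Fintype.card κ * M := by
  -- Induction on the set `s` of arguments released from their nets to the full ball; each release
  -- costs a factor 2.
  have key : ∀ s : Finset κ, ∀ b : ∀ k, E k, (∀ k ∈ s, ‖b k‖ ≤ 1) → (∀ k ∉ s, b k ∈ N k) →
      |f b| ≤ 2 ^ s.card * M := by
    intro s
    induction s using Finset.induction_on with
    | empty => intro b _ h; simpa using hM b fun k => h k (by simp)
    | insert a s ha ih =>
      intro b h1 h2
      have h3 : ∀ c ∈ N a, |f.toLinearMap b a c| ≤ 2 ^ s.card * M := by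
        intro c hc
        refine ih (Function.update b a c) (fun k hk => ?_) (fun k hk => ?_)
        · rw [Function.update_of_ne (by rintro rfl; exact ha hk)]
          exact h1 k (Finset.mem_insert_of_mem hk)
        · by_cases hka : k = a
          · subst hka; simpa using hc
          · rw [Function.update_of_ne hka]
            exact h2 k (by simp [hka, hk])
      have h4 := abs_le_two_mul_of_half_net (hN a) (f.toLinearMap b a) h3
        (h1 a (Finset.mem_insert_self _ _))
      rw [MultilinearMap.toLinearMap_apply, Function.update_eq_self] at h4
      rw [Finset.card_insert_of_notMem ha, pow_succ]
      linarith
  simpa using key Finset.univ b (fun k _ => hb k) (by simp)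

/-- The multilinear form `(b₁, …, b_m) ↦ ∑ W_{i₁ … i_m} b₁(i₁) ⋯ b_m(i_m)`. -/
noncomputable def tensorForm {κ : Type*} [Fintype κ] [DecidableEq κ] {d : κ → ℕ}
    (W : (∀ k, Fin (d k)) → ℝ) :
    MultilinearMap ℝ (fun k => EuclideanSpace ℝ (Fin (d k))) ℝ :=
  ∑ s, W s • (MultilinearMap.mkPiAlgebra ℝ κ ℝ).compLinearMap
    fun k => EuclideanSpace.projₗ (s k)

lemma tensorForm_apply {κ : Type*} [Fintype κ] [DecidableEq κ] {d : κ → ℕ}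
    (W : (∀ k, Fin (d k)) → ℝ) (b : ∀ k, EuclideanSpace ℝ (Fin (d k))) :
    tensorForm W b = ∑ s, (∏ k, b k (s k)) * W s := by
  simp [tensorForm, mul_comm]

lemma sum_prod_sq_le_one {κ : Type*} [Fintype κ] [DecidableEq κ] {d : κ → ℕ}
    (b : ∀ k, EuclideanSpace ℝ (Fin (d k))) (hb : ∀ k, ‖b k‖ ≤ 1) :
    ∑ s : ∀ k, Fin (d k), (∏ k, b k (s k)) ^ 2 ≤ 1 := by
  simp_rw [← Finset.prod_pow]
  rw [← Fintype.prod_sum (fun k i => (b k i) ^ 2)]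
  refine Finset.prod_le_one (fun k _ => Finset.sum_nonneg fun i _ => sq_nonneg _) fun k _ => ?_
  rw [← EuclideanSpace.real_norm_sq_eq]
  exact pow_le_one₀ (norm_nonneg _) (hb k)

/-- High-probability bound for the injective norm of a tensor with independent sub-Gaussian
entries. -/
lemma measure_tensorForm_large_le {κ : Type*} [Fintype κ] [DecidableEq κ] {d : κ → ℕ}
    {Ω : Type*} [MeasurableSpace Ω] {μ : Measure Ω}
    [IsProbabilityMeasure μ] {e : (∀ k, Fin (d k)) → Ω → ℝ} (hind : iIndepFun e μ) {c : NNReal}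
    (hc : 0 < c) (hsub : ∀ s, HasSubgaussianMGF (e s) c μ) (hd : 1 ≤ ∑ k, d k)
    {ε : ℝ} (hε : 0 < ε) :
    μ {ω | ¬ ∀ b : ∀ k, EuclideanSpace ℝ (Fin (d k)), (∀ k, ‖b k‖ ≤ 1) →
        (∑ s, (∏ k, b k (s k)) * e s ω) ^ 2 ≤
          (2 ^ Fintype.card κ) ^ 2 * (4 * c * (1 + 1 / ε)) * (∑ k, d k : ℕ)} ≤
      ENNReal.ofReal ε := by
  choose N hNcard hN1 hN using fun k => exists_half_net (EuclideanSpace ℝ (Fin (d k)))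
  set D : ℕ := ∑ k, d k with hD
  have hD1 : (1 : ℝ) ≤ D := by exact_mod_cast hd
  -- Chosen so that `x ^ 2 / (2 * c) = 2 * D + (2 / ε) * D`: the first term beats the `5 ^ D` net
  -- points because `5 ≤ exp 2`, and the second leaves `2 * exp (-(2 / ε)) ≤ ε`.
  set x : ℝ := Real.sqrt (4 * c * (1 + 1 / ε) * D) with hx
  have hx2 : x ^ 2 = 4 * c * (1 + 1 / ε) * D := Real.sq_sqrt (by positivity)
  let S : Finset (∀ k, EuclideanSpace ℝ (Fin (d k))) := Fintype.piFinset N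
  have hS : S.card ≤ 5 ^ D := by
    rw [Fintype.card_piFinset, hD, ← Finset.prod_pow_eq_pow_sum]
    exact Finset.prod_le_prod' fun k _ => by simpa using hNcard k
  have hincl : {ω | ¬ ∀ b : ∀ k, EuclideanSpace ℝ (Fin (d k)), (∀ k, ‖b k‖ ≤ 1) →
        (∑ s, (∏ k, b k (s k)) * e s ω) ^ 2 ≤
          (2 ^ Fintype.card κ) ^ 2 * (4 * c * (1 + 1 / ε)) * D} ⊆
      ⋃ b ∈ S, {ω | x ≤ |∑ s, (∏ k, b k (s k)) * e s ω|} := by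
    intro ω hω
    by_contra hnot
    simp only [Set.mem_iUnion, Set.mem_ofPred_eq, not_exists, not_le] at hnot
    refine hω fun b hb => ?_
    have h := multilinear_abs_le_of_half_nets (N := fun k => (N k : Set _)) hN
      (tensorForm fun s => e s ω) (M := x)
      (fun b hb => by
        rw [tensorForm_apply]
        exact (hnot b (Fintype.mem_piFinset.2 hb)).le) b hb
    rw [tensorForm_apply] at h
    calc _ = |∑ s, (∏ k, b k (s k)) * e s ω| ^ 2 := (sq_abs _).symm
      _ ≤ (2 ^ Fintype.card κ * x) ^ 2 := by gcongr
      _ = _ := by rw [mul_pow, hx2]; ring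
  refine (measure_mono hincl).trans ((measure_biUnion_finset_le _ _).trans ?_)
  have hbound : ∀ b ∈ S, μ {ω | x ≤ |∑ s, (∏ k, b k (s k)) * e s ω|} ≤
      ENNReal.ofReal (2 * Real.exp (-x ^ 2 / (2 * c))) := fun b hb =>
    measure_abs_linear_ge_le hind hsub _
      (sum_prod_sq_le_one b fun k => hN1 k _ (Fintype.mem_piFinset.1 hb k)) (Real.sqrt_nonneg _)
  refine (Finset.sum_le_card_nsmul _ _ _ hbound).trans ?_
  rw [nsmul_eq_mul, ← ENNReal.ofReal_natCast, ← ENNReal.ofReal_mul (by positivity)]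
  apply ENNReal.ofReal_le_ofReal
  have h5 : (5 : ℝ) ≤ Real.exp 2 := by
    have h := Real.exp_one_gt_d9
    have : Real.exp 2 = Real.exp 1 * Real.exp 1 := by rw [← Real.exp_add]; norm_num
    nlinarith
  have hexp : -x ^ 2 / (2 * c) = -(2 * D) - 2 / ε * D := by
    rw [hx2]
    have : (c : ℝ) ≠ 0 := by exact_mod_cast hc.ne'
    field_simp
    ring
  calc (S.card : ℝ) * (2 * Real.exp (-x ^ 2 / (2 * c)))
      ≤ (5 : ℝ) ^ D * (2 * Real.exp (-x ^ 2 / (2 * c))) := by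
        gcongr; exact_mod_cast hS
    _ ≤ Real.exp 2 ^ D * (2 * Real.exp (-x ^ 2 / (2 * c))) := by gcongr
    _ = 2 * Real.exp (-(2 / ε * D)) := by
        rw [← Real.exp_nat_mul, hexp, mul_left_comm, ← Real.exp_add]
        congr 2; ring
    _ ≤ 2 * Real.exp (-(2 / ε)) := by
        gcongr
        exact le_mul_of_one_le_right (by positivity) hD1
    _ ≤ ε := by
        rw [Real.exp_neg, ← div_eq_mul_inv, div_le_iff₀ (Real.exp_pos _)]
        have := Real.add_one_le_exp (2 / ε)
        have h2 : ε * (2 / ε) = 2 := by field_simp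
        nlinarith

end TensorFactor

/-! ### Deterministic bound: low-dimensional signal differences and least squares. -/

namespace TensorFactor

/-- The columns of two `p × r` matrices lie in the range of a projection `B Bᵀ`, where `B` has at
most `2r` columns, each of norm at most one. -/
lemma exists_projection_of_columns {p r : ℕ} (A A' : Matrix (Fin p) (Fin r) ℝ) :
    ∃ m ≤ 2 * r, ∃ B : Matrix (Fin p) (Fin m) ℝ,
      (∀ j, ‖(WithLp.toLp 2 fun i => B i j : EuclideanSpace ℝ (Fin p))‖ ≤ 1) ∧
      B * B.transpose * A = A ∧ B * B.transpose * A' = A' := by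
  let v : Fin r ⊕ Fin r → EuclideanSpace ℝ (Fin p) :=
    Sum.elim (fun j => WithLp.toLp 2 fun i => A i j) fun j => WithLp.toLp 2 fun i => A' i j
  let V := Submodule.span ℝ (Set.range v)
  have hv : ∀ s, v s ∈ V := fun s => Submodule.subset_span (Set.mem_range_self s)
  let u := stdOrthonormalBasis ℝ V
  have hm : Module.finrank ℝ V ≤ 2 * r := by
    refine (finrank_range_le_card v).trans ?_
    simp [two_mul]
  let B : Matrix (Fin p) (Fin (Module.finrank ℝ V)) ℝ :=
    fun i j => (u j : EuclideanSpace ℝ (Fin p)) i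
  have hproj : ∀ x ∈ V, ∀ i, ∑ j, B i j * ∑ i', B i' j * x i' = x i := by
    intro x hx i
    have h := u.sum_repr' ⟨x, hx⟩
    have h' := congrArg (fun y : V => (y : EuclideanSpace ℝ (Fin p)) i) h
    simp only [Submodule.coe_sum, Submodule.coe_smul, Submodule.coe_inner, WithLp.ofLp_sum,
      WithLp.ofLp_smul, Finset.sum_apply, Pi.smul_apply, smul_eq_mul, PiLp.inner_apply,
      RCLike.inner_apply, conj_trivial] at h'
    rw [← h']
    refine Finset.sum_congr rfl fun j _ => ?_
    rw [mul_comm]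
    simp only [B, mul_comm]
  have hcol : ∀ C : Matrix (Fin p) (Fin r) ℝ,
      (∀ j, (WithLp.toLp 2 fun i => C i j : EuclideanSpace ℝ (Fin p)) ∈ V) →
      B * B.transpose * C = C := by
    intro C hC
    ext i j
    rw [Matrix.mul_assoc]
    simpa only [Matrix.mul_apply, Matrix.transpose_apply] using! hproj _ (hC j) i
  refine ⟨_, hm, B, fun j => ?_, hcol A fun j => hv (Sum.inl j), hcol A' fun j => hv (Sum.inr j)⟩
  exact (u.orthonormal.1 j).le

lemma tensorNorm_sq {K : ℕ} {d : Fin K → ℕ} (X : Tensor d) : tensorNorm X ^ 2 = ∑ i, X i ^ 2 :=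
  Real.sq_sqrt (Finset.sum_nonneg fun _ _ => sq_nonneg _)

lemma tuckerProd_sub {K : ℕ} {r p : Fin K → ℕ} (F G : Tensor r)
    (A : ∀ k, Matrix (Fin (p k)) (Fin (r k)) ℝ) :
    tuckerProd (F - G) A = tuckerProd F A - tuckerProd G A := by
  ext i
  simp [tuckerProd, sub_mul]

lemma tuckerProd_tuckerProd {K : ℕ} {r p q : Fin K → ℕ} (F : Tensor r)
    (A : ∀ k, Matrix (Fin (p k)) (Fin (r k)) ℝ) (B : ∀ k, Matrix (Fin (q k)) (Fin (p k)) ℝ) :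
    tuckerProd (tuckerProd F A) B = tuckerProd F fun k => B k * A k := by
  ext i
  simp only [tuckerProd, Matrix.mul_apply, Finset.sum_mul]
  rw [Finset.sum_comm]
  refine Finset.sum_congr rfl fun j _ => ?_
  rw [Fintype.prod_sum, Finset.mul_sum]
  refine Finset.sum_congr rfl fun s _ => ?_
  rw [Finset.prod_mul_distrib]
  ring

/-- Adjointness of the mode products; it transfers inner products with `Δ` to the compressed
coordinates. -/
lemma sum_mul_tuckerProd {K : ℕ} {r p : Fin K → ℕ} (x : Tensor p) (y : Tensor r)
    (B : ∀ k, Matrix (Fin (p k)) (Fin (r k)) ℝ) :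
    ∑ i, x i * tuckerProd y B i = ∑ j, tuckerProd x (fun k => (B k).transpose) j * y j := by
  simp only [tuckerProd, Finset.mul_sum, Finset.sum_mul]
  rw [Finset.sum_comm]
  refine Finset.sum_congr rfl fun j _ => Finset.sum_congr rfl fun i _ => ?_
  simp only [Matrix.transpose_apply]
  ring

/-- Duality: test on `v / ‖v‖`, or on `0` when `v` vanishes. -/
lemma sum_sq_le_of_forall_unit {T : ℕ} (v : Fin T → ℝ) {Q : ℝ}
    (h : ∀ a : EuclideanSpace ℝ (Fin T), ‖a‖ ≤ 1 → (∑ t, a t * v t) ^ 2 ≤ Q) :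
    ∑ t, v t ^ 2 ≤ Q := by
  let w : EuclideanSpace ℝ (Fin T) := WithLp.toLp 2 v
  have hw : ‖w‖ ^ 2 = ∑ t, v t ^ 2 := EuclideanSpace.real_norm_sq_eq w
  rw [← hw]
  rcases eq_or_ne ‖w‖ 0 with h0 | h0
  · have := h 0 (by simp)
    rw [h0]
    simpa using this
  · have h1 := h (‖w‖⁻¹ • w) (by rw [norm_smul, norm_inv, norm_norm, inv_mul_cancel₀ h0])
    have h2 : ∑ t, (‖w‖⁻¹ • w) t * v t = ‖w‖ := by
      have : ∀ t, (‖w‖⁻¹ • w) t * v t = ‖w‖⁻¹ * v t ^ 2 := fun t => by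
        simp only [PiLp.smul_apply, smul_eq_mul, w]; ring
      simp_rw [this]
      rw [← Finset.mul_sum, ← hw]
      field_simp
    rwa [h2] at h1

/-- If the signal difference `Δ` satisfies `‖Δ‖² ≤ 2⟨E, Δ⟩`, then `‖Δ‖²` is at most a constant
times the squared injective norm of `E`. -/
lemma sum_tensorNorm_sq_le {K : ℕ} {r p : Fin K → ℕ} {T : ℕ} (θ θ' : Param r p T)
    (E : Fin T → Tensor p) {Q : ℝ}
    (hbasic : ∑ t, tensorNorm (θ.signal t - θ'.signal t) ^ 2 ≤
      2 * ∑ t, ∑ i, E t i * (θ.signal t - θ'.signal t) i)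
    (hQ : ∀ a : EuclideanSpace ℝ (Fin T), ‖a‖ ≤ 1 →
      ∀ b : ∀ k, EuclideanSpace ℝ (Fin (p k)), (∀ k, ‖b k‖ ≤ 1) →
        (∑ t, a t * ∑ i, E t i * ∏ k, b k (i k)) ^ 2 ≤ Q) :
    ∑ t, tensorNorm (θ.signal t - θ'.signal t) ^ 2 ≤ 4 * (∏ k, 2 * r k : ℕ) * Q := by
  have hQ0 : 0 ≤ Q := by simpa using hQ 0 (by simp) 0 (by simp)
  choose m hm B hB hBA hBA' using fun k => exists_projection_of_columns (θ.A k) (θ'.A k)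
  set Δ : Fin T → Tensor p := fun t => θ.signal t - θ'.signal t with hΔ
  let c : Fin T → Tensor m := fun t => tuckerProd (Δ t) fun k => (B k).transpose
  let w : Fin T → Tensor m := fun t => tuckerProd (E t) fun k => (B k).transpose
  have hc : ∀ t, tuckerProd (c t) B = Δ t := by
    intro t
    simp only [c, hΔ, Param.signal, tuckerProd_sub, tuckerProd_tuckerProd, hBA, hBA',
      ← Matrix.mul_assoc]
  have hnorm : ∀ t, tensorNorm (Δ t) ^ 2 = ∑ j, c t j ^ 2 := by
    intro t
    calc tensorNorm (Δ t) ^ 2 = ∑ i, Δ t i * tuckerProd (c t) B i := by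
          rw [tensorNorm_sq, hc]; simp_rw [sq]
      _ = ∑ j, c t j ^ 2 := by rw [sum_mul_tuckerProd]; simp_rw [sq]; rfl
  have hinner : ∀ t, ∑ i, E t i * Δ t i = ∑ j, w t j * c t j := by
    intro t
    rw [← hc, sum_mul_tuckerProd]
  -- For fixed `j`, `w t j` contracts `E t` with one column of each `B k`, all in unit balls, so
  -- `hQ` and duality in `t` bound the sum over time by `Q`.
  have hw : ∑ t, ∑ j, w t j ^ 2 ≤ (∏ k, 2 * r k : ℕ) * Q := by
    rw [Finset.sum_comm]
    calc ∑ j, ∑ t, w t j ^ 2 ≤ ∑ _j : (∀ k, Fin (m k)), Q :=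
          Finset.sum_le_sum fun j _ => sum_sq_le_of_forall_unit _ fun a ha =>
            hQ a ha (fun k => WithLp.toLp 2 fun i => B k i (j k)) fun k => hB k (j k)
      _ = (∏ k, m k : ℕ) * Q := by simp
      _ ≤ (∏ k, 2 * r k : ℕ) * Q := by
          gcongr with k
          exact hm k
  have hsum : ∑ t, tensorNorm (Δ t) ^ 2 = ∑ t, ∑ j, c t j ^ 2 :=
    Finset.sum_congr rfl fun t _ => hnorm t
  -- Young's inequality with weight `1 / 2` on `c`, so that half of `‖Δ‖²` is absorbed; hence the
  -- final constant 4.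
  have hcs : 2 * ∑ t, ∑ i, E t i * Δ t i ≤
      1 / 2 * ∑ t, ∑ j, c t j ^ 2 + 2 * ∑ t, ∑ j, w t j ^ 2 := by
    simp_rw [hinner, Finset.mul_sum, ← Finset.sum_add_distrib]
    gcongr with t _ j _
    nlinarith [sq_nonneg (c t j - 2 * w t j)]
  change ∑ t, tensorNorm (Δ t) ^ 2 ≤ _
  have hbasic' : ∑ t, tensorNorm (Δ t) ^ 2 ≤ 2 * ∑ t, ∑ i, E t i * Δ t i := hbasic
  linarith

/-- The basic inequality of least squares. -/
lemma IsLeastSquares.basic_inequality {K : ℕ} {r p : Fin K → ℕ} {T : ℕ}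
    {rowSet : ∀ k, Set (Fin (r k) → ℝ)} {factorSet : Set (Tensor r)} {E : Fin T → Tensor p}
    {θ θ₀ : Param r p T} (hT : 1 ≤ T)
    (h : IsLeastSquares rowSet factorSet (fun t => θ₀.signal t + E t) θ)
    (h₀ : θ₀ ∈ paramSpace rowSet factorSet p T) :
    ∑ t, tensorNorm (θ.signal t - θ₀.signal t) ^ 2 ≤
      2 * ∑ t, ∑ i, E t i * (θ.signal t - θ₀.signal t) i := by
  have hle := h.2 h₀
  simp only [Set.mem_ofPred_eq, lsLoss] at hle
  have hle' := le_of_mul_le_mul_left hle (by positivity)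
  simp only [tensorNorm_sq, Pi.sub_apply, Pi.add_apply, add_sub_cancel_left] at hle' ⊢
  have hexp : ∑ t, ∑ i, (θ₀.signal t i + E t i - θ.signal t i) ^ 2 =
      ∑ t, ∑ i, E t i ^ 2 - 2 * ∑ t, ∑ i, E t i * (θ.signal t i - θ₀.signal t i) +
        ∑ t, ∑ i, (θ.signal t i - θ₀.signal t i) ^ 2 := by
    simp_rw [Finset.mul_sum, ← Finset.sum_sub_distrib, ← Finset.sum_add_distrib]
    refine Finset.sum_congr rfl fun t _ => Finset.sum_congr rfl fun i _ => ?_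
    ring
  linarith

/-! ### The rate, the stacked noise and the conclusion. -/

lemma totalDim_eq_mul_codim {K : ℕ} (p : Fin K → ℕ) (k : Fin K) :
    totalDim p = p k * codim p k :=
  (Finset.mul_prod_erase _ _ (Finset.mem_univ k)).symm

lemma rateL_pos {K : ℕ} (hK : 1 ≤ K) {p : Fin K → ℕ} {T : ℕ} (hT : 1 ≤ T)
    (hp : ∀ k, 1 ≤ p k) : 0 < rateL p T := by
  have : Nonempty (Fin K) := ⟨⟨0, hK⟩⟩
  obtain ⟨k, hk⟩ := exists_eq_ciInf_of_finite (f := fun k => (T : ℝ) * (codim p k : ℝ))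
  have h1 : 0 < totalDim p := Finset.prod_pos fun k _ => hp k
  have h2 : 0 < codim p k := Finset.prod_pos fun k _ => hp k
  rw [rateL, ← hk]
  positivity

/-- After division by `T p`, the summand `T` becomes `1 / p` and `p_k` becomes `1 / (T p₋ₖ)`: `K +
1` terms, each at most `1 / L`. -/
lemma sum_dim_div_le {K : ℕ} (hK : 1 ≤ K) {p : Fin K → ℕ} {T : ℕ} (hT : 1 ≤ T)
    (hp : ∀ k, 1 ≤ p k) :
    ((T : ℝ) * totalDim p)⁻¹ * (T + ∑ k, p k : ℕ) ≤ (K + 1) / rateL p T := by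
  have hL := rateL_pos hK hT hp
  have h1 : 0 < totalDim p := Finset.prod_pos fun k _ => hp k
  have hle1 : rateL p T ≤ totalDim p := min_le_left _ _
  have hle2 : ∀ k, rateL p T ≤ T * codim p k := fun k =>
    (min_le_right _ _).trans (ciInf_le (Set.finite_range _).bddBelow k)
  rw [inv_mul_eq_div, div_le_div_iff₀ (by positivity) hL]
  push_cast
  have h3 : ∀ k, (p k : ℝ) * rateL p T ≤ T * totalDim p := by
    intro k
    rw [totalDim_eq_mul_codim p k]
    push_cast
    nlinarith [mul_le_mul_of_nonneg_left (hle2 k) (Nat.cast_nonneg (α := ℝ) (p k))]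
  have h4 : ∑ k, (p k : ℝ) * rateL p T ≤ ∑ _k : Fin K, (T : ℝ) * totalDim p :=
    Finset.sum_le_sum fun k _ => h3 k
  rw [← Finset.sum_mul] at h4
  simp only [Finset.sum_const, Finset.card_univ, Fintype.card_fin, nsmul_eq_mul] at h4
  nlinarith [mul_le_mul_of_nonneg_left hle1 (Nat.cast_nonneg (α := ℝ) T)]

/-- The injective norm of the stacked noise tensor is `O_P(√(T + p₁ + ⋯ + p_K))`. -/
lemma measure_noise_large_le {K : ℕ} {p : Fin K → ℕ} {T : ℕ} (hT : 1 ≤ T) {Ω : Type*}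
    [MeasurableSpace Ω] {μ : Measure Ω} [IsProbabilityMeasure μ] {E : Fin T → Ω → Tensor p}
    (hind : iIndepFun (fun (s : Fin T × (∀ k, Fin (p k))) ω => E s.1 ω s.2) μ)
    {c : NNReal} (hc : 0 < c) (hsub : ∀ t i, HasSubgaussianMGF (fun ω => E t ω i) c μ)
    {ε : ℝ} (hε : 0 < ε) :
    μ {ω | ¬ ∀ a : EuclideanSpace ℝ (Fin T), ‖a‖ ≤ 1 →
      ∀ b : ∀ k, EuclideanSpace ℝ (Fin (p k)), (∀ k, ‖b k‖ ≤ 1) →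
        (∑ t, a t * ∑ i, E t ω i * ∏ k, b k (i k)) ^ 2 ≤
          (2 ^ (K + 1)) ^ 2 * (4 * c * (1 + 1 / ε)) * (T + ∑ k, p k : ℕ)} ≤
      ENNReal.ofReal ε := by
  -- Time becomes the extra mode `none` of a tensor of order `K + 1`.
  let d : Option (Fin K) → ℕ := fun o => o.elim T p
  let φ : (∀ o, Fin (d o)) ≃ Fin T × (∀ k, Fin (p k)) := Equiv.piOptionEquivProd
  have hd : ∑ o, d o = T + ∑ k, p k := Fintype.sum_option d
  have h := measure_tensorForm_large_le (d := d) (e := fun s ω => E (φ s).1 ω (φ s).2)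
    (hind.precomp φ.injective) hc (fun s => hsub _ _) (by omega) hε
  rw [hd] at h
  refine (measure_mono ?_).trans h
  intro ω hω hall
  refine hω fun a ha b hb => ?_
  let b' : ∀ o, EuclideanSpace ℝ (Fin (d o)) := fun o => match o with
    | none => a
    | some k => b k
  have h1 := hall b' fun o => match o with
    | none => ha
    | some k => hb k
  have h2 : ∑ s, (∏ o, b' o (s o)) * E (φ s).1 ω (φ s).2 =
      ∑ t, a t * ∑ i, E t ω i * ∏ k, b k (i k) := by
    calc _ = ∑ s, a (φ s).1 * (E (φ s).1 ω (φ s).2 * ∏ k, b k ((φ s).2 k)) := by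
          refine Finset.sum_congr rfl fun s _ => ?_
          rw [Fintype.prod_option, mul_assoc, mul_comm (∏ k, _)]
          rfl
      _ = ∑ x : Fin T × (∀ k, Fin (p k)), a x.1 * (E x.1 ω x.2 * ∏ k, b k (x.2 k)) :=
          φ.sum_comp fun x => a x.1 * (E x.1 ω x.2 * ∏ k, b k (x.2 k))
      _ = _ := by
          rw [Fintype.sum_prod_type]
          simp_rw [Finset.mul_sum]
  rw [h2] at h1
  simpa using h1

end TensorFactor

theorem mainTheorem8 {K : ℕ} (hK : 1 ≤ K) (r : Fin K → ℕ)
    (rowSet : ∀ k, Set (Fin (r k) → ℝ)) (factorSet : Set (TensorFactor.Tensor r))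
    {ι : Type*} (l : Filter ι) (T : ι → ℕ) (p : ι → Fin K → ℕ)
    (hT : Tendsto T l atTop) (hp : ∀ k, Tendsto (fun n => p n k) l atTop)
    {Ω : ι → Type*} [∀ n, MeasurableSpace (Ω n)]
    (μ : ∀ n, Measure (Ω n)) [∀ n, IsProbabilityMeasure (μ n)]
    (θ₀ : ∀ n, TensorFactor.Param r (p n) (T n))
    (E : ∀ n, Fin (T n) → Ω n → TensorFactor.Tensor (p n))
    (hE : ∀ n t, Measurable (E n t))
    (X : ∀ n, Fin (T n) → Ω n → TensorFactor.Tensor (p n))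
    (hX : ∀ n t ω, X n t ω = (θ₀ n).signal t + E n t ω)
    (h₁ : TensorFactor.LoadingFactorAssumption rowSet factorSet l T p θ₀)
    (h₂ : TensorFactor.NoiseIndependent T p μ E)
    (h₃ : TensorFactor.NoiseSubGaussian T p μ E)
    (θhat : ∀ n, Ω n → TensorFactor.Param r (p n) (T n))
    (hθhat : ∀ n, ∀ᵐ ω ∂(μ n),
      TensorFactor.IsLeastSquares rowSet factorSet (fun t => X n t ω) (θhat n ω)) :
    TensorFactor.IsBigOP l μ
      (fun n ω => ((T n : ℝ) * (TensorFactor.totalDim (p n) : ℝ))⁻¹ *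
        ∑ t, TensorFactor.tensorNorm ((θhat n ω).signal t - (θ₀ n).signal t) ^ 2)
      (fun n => 1 / TensorFactor.rateL (p n) (T n)) := by
  intro ε hε
  obtain ⟨ν, hν, hmom⟩ := h₃.moments
  set c : NNReal := (4 * ν ^ 2).toNNReal with hcdef
  have hc : 0 < c := by rw [hcdef, Real.toNNReal_pos]; positivity
  set C : ℝ := (2 ^ (K + 1)) ^ 2 * (4 * c * (1 + 1 / ε)) with hC
  have hC0 : 0 ≤ C := by positivity
  -- Factors from the deterministic bound, the noise bound and the rate comparison respectively.
  refine ⟨4 * (∏ k, 2 * r k : ℕ) * C * (K + 1), ?_⟩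
  filter_upwards [hT.eventually_ge_atTop 1,
    eventually_all.2 fun k => (hp k).eventually_ge_atTop 1] with n hTn hpn
  have hmeas : ∀ t i, Measurable fun ω => E n t ω i := fun t i =>
    (measurable_pi_apply i).comp (hE n t)
  -- Outside a null set, exceeding the bound forces the noise event to occur; monotonicity of outer
  -- measure suffices, so `θhat` need not be measurable.
  refine le_trans (measure_mono_ae ?_) (TensorFactor.measure_noise_large_le hTn (h₂ n) hc
    (fun t i => TensorFactor.hasSubgaussianMGF_of_even_moments (hmeas t i)
      (h₃.integrable n t i) (h₃.mean_zero n t i) fun d hd => hmom n t i d hd) hε)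
  filter_upwards [hθhat n] with ω hω hlarge hQ
  simp only [hX] at hω
  have hdet := TensorFactor.sum_tensorNorm_sq_le _ _ _
    (hω.basic_inequality hTn (h₁.true_mem n)) hQ
  refine absurd hlarge (not_lt.2 ?_)
  rw [abs_of_nonneg (by positivity)]
  have hrate := TensorFactor.sum_dim_div_le hK hTn hpn
  calc _ ≤ ((T n : ℝ) * (TensorFactor.totalDim (p n) : ℝ))⁻¹ *
        (4 * (∏ k, 2 * r k : ℕ) * (C * (T n + ∑ k, p n k : ℕ))) := by
        gcongr
    _ = 4 * (∏ k, 2 * r k : ℕ) * C * (((T n : ℝ) * (TensorFactor.totalDim (p n) : ℝ))⁻¹ *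
        (T n + ∑ k, p n k : ℕ)) := by ring
    _ ≤ 4 * (∏ k, 2 * r k : ℕ) * C * ((K + 1) / TensorFactor.rateL (p n) (T n)) := by
        gcongr
    _ = _ := by ring
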